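/- For $n \ge 1$, let $\Pi_n^w$ be the poset of weighted partitions of $[n]=\{1,\dots,n\}$: its elements are the sets $\{B_1^{v_1},\dots,B_t^{v_t}\}$ where $\{B_1,\dots,B_t\}$ is a partition of $[n]$ into nonempty blocks and $v_k\in\{0,1,\dots,|B_k|-1\}$ for every $k$, and $\{A_1^{w_1},\dots,A_s^{w_s}\}\le\{B_1^{v_1},\dots,B_t^{v_t}\}$ if and only if the partition $\{A_1,\dots,A_s\}$ refines $\{B_1,\dots,B_t\}$ and, whenever $B_k=A_{i_1}\cup\dots\cup A_{i_l}$ (with distinct $i_1,\dots,i_l$), one has $v_k-(w_{i_1}+\dots+w_{i_l})\in\{0,1,\dots,l-1\}$. Let $\hat 0=\{\{1\}^0,\dots,\{n\}^0\}$ be its minimum element, write $[n]^i$ for the one-block weighted partition $\{[n]^i\}$, $0\le i\le n-1$, and let $\mu_{\Pi_n^w}$ be the Möbius function of $\Pi_n^w$. Then for all $n\ge 1$, as polynomials in $t$ with integer coefficients, $$\sum_{i=0}^{n-1}\mu_{\Pi_n^w}(\hat 0,[n]^i)\,t^i=(-1)^{n-1}\prod_{i=1}^{n-1}\bigl((n-i)+it\bigr).$$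 Consequently, $$\sum_{i=0}^{n-1}\mu_{\Pi_n^w}(\hat 0,[n]^i)=(-1)^{n-1}n^{n-1}.$$ -/

import Mathlib

open Finset

/-- A weighted partition `{B₁^{v₁}, …, B_t^{v_t}}` of a finite type `α`: a partition of `α` into
nonempty blocks, with a weight `v ∈ {0, 1, …, |B| - 1}` for every block `B`. The weight is recorded
as a function on all finsets that vanishes off the blocks, so that equality of weighted partitions
is equality of the sets of weighted blocks. -/
@[ext]
structure WeightedPartition (α : Type*) [Fintype α] [DecidableEq α] where
  partition : Finpartition (univ : Finset α)
  weight : Finset α → ℕ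
  weight_lt : ∀ B ∈ partition.parts, weight B < #B
  weight_eq_zero : ∀ B ∉ partition.parts, weight B = 0

namespace WeightedPartition

variable {α : Type*} [Fintype α] [DecidableEq α]

/-- The blocks of `P` contained in the set `B`. -/
def blocksIn (P : WeightedPartition α) (B : Finset α) : Finset (Finset α) :=
  {A ∈ P.partition.parts | A ⊆ B}

/-- `P ≤ Q` if the partition of `P` refines that of `Q` and, whenever a block `B` of `Q` is the
union of the blocks `A₁, …, A_l` of `P`, the weight of `B` minus the sum of the weights of the `Aᵢ`
lies in `{0, 1, …, l - 1}`. -/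
instance instLE : LE (WeightedPartition α) where
  le P Q := P.partition ≤ Q.partition ∧
    ∀ B ∈ Q.partition.parts, ∃ j < #(P.blocksIn B),
      Q.weight B = ∑ A ∈ P.blocksIn B, P.weight A + j

theorem le_def {P Q : WeightedPartition α} : P ≤ Q ↔ P.partition ≤ Q.partition ∧
    ∀ B ∈ Q.partition.parts, ∃ j < #(P.blocksIn B),
      Q.weight B = ∑ A ∈ P.blocksIn B, P.weight A + j := Iff.rfl

theorem blocksIn_self (P : WeightedPartition α) {B : Finset α} (hB : B ∈ P.partition.parts) :
    P.blocksIn B = {B} := by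
  ext A
  simp only [blocksIn, mem_filter, mem_singleton]
  constructor
  · rintro ⟨hA, hAB⟩
    obtain ⟨x, hx⟩ := P.partition.nonempty_of_mem_parts hA
    exact P.partition.eq_of_mem_parts hA hB hx (hAB hx)
  · rintro rfl
    exact ⟨hB, Subset.rfl⟩

theorem blocksIn_biUnion {P Q R : WeightedPartition α} (hPQ : P.partition ≤ Q.partition)
    (hQR : Q.partition ≤ R.partition) {C : Finset α} (hC : C ∈ R.partition.parts) :
    P.blocksIn C = (Q.blocksIn C).biUnion P.blocksIn := by
  ext A
  simp only [blocksIn, mem_filter, mem_biUnion]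
  constructor
  · rintro ⟨hA, hAC⟩
    obtain ⟨B, hB, hAB⟩ := hPQ hA
    obtain ⟨D, hD, hBD⟩ := hQR hB
    obtain ⟨x, hx⟩ := P.partition.nonempty_of_mem_parts hA
    have := R.partition.eq_of_mem_parts hD hC (hBD (hAB hx)) (hAC hx)
    subst this
    exact ⟨B, ⟨hB, hBD⟩, hA, hAB⟩
  · rintro ⟨B, ⟨_, hBC⟩, hA, hAB⟩
    exact ⟨hA, Subset.trans hAB hBC⟩

theorem blocksIn_disjoint (P Q : WeightedPartition α) (C : Finset α) :
    ((Q.blocksIn C : Finset (Finset α)) : Set (Finset α)).PairwiseDisjoint P.blocksIn := by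
  intro B hB B' hB' hne
  rw [Function.onFun, Finset.disjoint_left]
  intro A hA hA'
  simp only [blocksIn, coe_filter, Set.mem_ofPred_eq, mem_filter] at hB hB' hA hA'
  obtain ⟨x, hx⟩ := P.partition.nonempty_of_mem_parts hA.1
  exact hne (Q.partition.eq_of_mem_parts hB.1 hB'.1 (hA.2 hx) (hA'.2 hx))

instance instPartialOrder : PartialOrder (WeightedPartition α) where
  le_refl P := by
    refine ⟨le_rfl, fun B hB => ⟨0, ?_, ?_⟩⟩ <;> simp [P.blocksIn_self hB]
  le_trans P Q R h₁ h₂ := by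
    refine ⟨h₁.1.trans h₂.1, fun C hC => ?_⟩
    obtain ⟨j, hj, hw⟩ := h₂.2 C hC
    have key : ∀ B ∈ Q.blocksIn C, ∃ k, k < #(P.blocksIn B) ∧
        Q.weight B = ∑ A ∈ P.blocksIn B, P.weight A + k :=
      fun B hB => h₁.2 B (mem_filter.1 hB).1
    choose! k hk hkw using key
    have hU := blocksIn_biUnion h₁.1 h₂.1 hC
    have hD := blocksIn_disjoint P Q C
    refine ⟨∑ B ∈ Q.blocksIn C, k B + j, ?_, ?_⟩
    · rw [hU, card_biUnion hD]
      have : ∑ B ∈ Q.blocksIn C, (k B + 1) ≤ ∑ B ∈ Q.blocksIn C, #(P.blocksIn B) :=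
        sum_le_sum fun B hB => hk B hB
      rw [sum_add_distrib, sum_const, smul_eq_mul, mul_one] at this
      omega
    · rw [hw, hU, sum_biUnion hD, sum_congr rfl hkw, sum_add_distrib, add_assoc]
  le_antisymm P Q h₁ h₂ := by
    have hp : P.partition = Q.partition := le_antisymm h₁.1 h₂.1
    refine WeightedPartition.ext hp (funext fun B => ?_)
    by_cases hB : B ∈ P.partition.parts
    · obtain ⟨j, hj, hw⟩ := h₁.2 B (hp ▸ hB)
      rw [P.blocksIn_self hB, card_singleton] at hj
      rw [P.blocksIn_self hB, sum_singleton] at hw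
      omega
    · rw [P.weight_eq_zero B hB, Q.weight_eq_zero B (hp ▸ hB)]

/-- The minimum element `0̂`: all blocks are singletons, of weight `0`. -/
instance instOrderBot : OrderBot (WeightedPartition α) where
  bot :=
    { partition := ⊥
      weight := fun _ => 0
      weight_lt := fun _ hB => card_pos.2 ((⊥ : Finpartition univ).nonempty_of_mem_parts hB)
      weight_eq_zero := fun _ _ => rfl }
  bot_le Q := by
    refine ⟨bot_le, fun B hB => ⟨Q.weight B, ?_, by simp⟩⟩
    refine (Q.weight_lt B hB).trans_eq ?_
    rw [← card_map ⟨fun a : α => ({a} : Finset α), singleton_injective⟩]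
    congr 1
    ext A
    simp only [blocksIn, mem_map, mem_filter, Finpartition.mem_bot_iff, Function.Embedding.coeFn_mk]
    constructor
    · rintro ⟨a, ha, rfl⟩
      exact ⟨⟨a, mem_univ a, rfl⟩, singleton_subset_iff.2 ha⟩
    · rintro ⟨⟨a, _, rfl⟩, h⟩
      exact ⟨a, singleton_subset_iff.1 h, rfl⟩

/-- The weighted partition with the single block `α`, of weight `i`; on `Fin n` it is `[n]^i`. -/
def full (i : ℕ) (hi : i < Fintype.card α) : WeightedPartition α where
  partition := Finpartition.indiscrete (a := (univ : Finset α)) (by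
    rw [bot_eq_empty, ← nonempty_iff_ne_empty, ← card_pos, card_univ]
    exact Nat.zero_lt_of_lt hi)
  weight := fun B => if B = univ then i else 0
  weight_lt := by
    intro B hB
    rw [Finpartition.indiscrete_parts, mem_singleton] at hB
    subst hB
    simpa using hi
  weight_eq_zero := by
    intro B hB
    rw [Finpartition.indiscrete_parts, mem_singleton] at hB
    exact if_neg hB

instance instFinite : Finite (WeightedPartition α) := by
  have hb : ∀ (P : WeightedPartition α) (B : Finset α), P.weight B < Fintype.card α + 1 := by
    intro P B
    by_cases hB : B ∈ P.partition.parts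
    · exact (P.weight_lt B hB).trans_le (B.card_le_univ.trans (Nat.le_succ _))
    · rw [P.weight_eq_zero B hB]
      exact Nat.succ_pos _
  refine Finite.of_injective (β := Finpartition (univ : Finset α) ×
    (Finset α → Fin (Fintype.card α + 1)))
    (fun P => (P.partition, fun B => ⟨P.weight B, hb P B⟩)) fun P Q h => ?_
  rw [Prod.mk.injEq] at h
  exact WeightedPartition.ext h.1 (funext fun B => congrArg Fin.val (congrFun h.2 B))

noncomputable instance instFintype : Fintype (WeightedPartition α) := Fintype.ofFinite _

noncomputable instance instDecidableEq : DecidableEq (WeightedPartition α) := Classical.decEq _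

noncomputable instance instLocallyFiniteOrder : LocallyFiniteOrder (WeightedPartition α) :=
  @Fintype.toLocallyFiniteOrder _ _ _ (Classical.decRel _) (Classical.decRel _)

/-- The value `μ(0̂, [n]^i)` of the Möbius function of the poset of weighted partitions of `[n]`. -/
noncomputable def moebius (n : ℕ) (i : Fin n) : ℤ :=
  IncidenceAlgebra.mu ℤ (⊥ : WeightedPartition (Fin n))
    (full i (i.isLt.trans_eq (Fintype.card_fin n).symm))

end WeightedPartition

/-! Write `w(R)` for the total weight and `#R` for the number of blocks of a weighted partition `R`,
and put `[m] = 1 + t + ⋯ + t^(m-1)`. The weights available to a block formed by merging `m` blocks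
are counted by `[m]`. The polynomials `umbral k`, written `u_k(x)` over `ℤ[t]`, form the basic
sequence of the delta operator `(E^t - E)/(t - 1)`, where `E^a` shifts `x` by `a`. Hence `∑_P ∏_{D ∈
P} [|D|] · u_{#P}(x) = x^|s|`, summed over the partitions `P` of `s` (`sum_finpartition_umbral`).

Let `c_k` be the coefficient of `x` in `u_k`. Comparing coefficients of `x` gives `∑_{R ≥ P}
t^(w(R)) c_{#R} = t^(w(P))` if `P` has one block, and `0` otherwise (`sum_ge`). Since `deg c_k < k`,
the coefficient of `t^i` in this sum only sees `R ≤ [n]^i`. It is therefore the recursion for `μ(·,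
[n]^i)` in the lower argument, so `μ(P, [n]^i)` is the coefficient of `t^i` in `t^(w(P)) c_{#P}`
(`mu_full`). At the minimum this is the coefficient of `t^i` in `c_n`, and `c_n` is an explicit
product. -/

/-! ### Partitions with a distinguished block -/

namespace Finpartition

variable {ι : Type*} [DecidableEq ι] {s : Finset ι}

/-- The partition of `s \ D` obtained by removing the block `D`. -/
def eraseBlock (P : Finpartition s) {D : Finset ι} (hD : D ∈ P.parts) : Finpartition (s \ D) where
  parts := P.parts.erase D
  supIndep := P.supIndep.subset (erase_subset _ _)
  sup_parts := by
    ext x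
    simp only [mem_sup, mem_erase, id, mem_sdiff]
    constructor
    · rintro ⟨B, ⟨hne, hB⟩, hx⟩
      exact ⟨P.subset hB hx, fun hxD => hne (P.eq_of_mem_parts hB hD hx hxD)⟩
    · rintro ⟨hx, hxD⟩
      obtain ⟨B, hB, hxB⟩ := P.exists_mem hx
      exact ⟨B, ⟨by rintro rfl; exact hxD hxB, hB⟩, hxB⟩
  bot_notMem h := P.bot_notMem (mem_of_mem_erase h)

/-- A partition with a distinguished block is a nonempty block with a partition of the rest. -/
theorem sum_sum_parts {M : Type*} [AddCommMonoid M] (s : Finset ι)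
    (F : Finset ι → Finset (Finset ι) → M) :
    ∑ P : Finpartition s, ∑ D ∈ P.parts, F D (P.parts.erase D) =
      ∑ D ∈ s.powerset.erase ∅, ∑ P : Finpartition (s \ D), F D P.parts := by
  rw [sum_sigma', sum_sigma']
  refine sum_bij (fun x hx => ⟨x.2, x.1.eraseBlock (mem_sigma.1 hx).2⟩) ?_ ?_ ?_ ?_
  · rintro ⟨P, D⟩ h
    have hD := (mem_sigma.1 h).2
    simp only [mem_sigma, mem_erase, mem_powerset, mem_univ, and_true]
    exact ⟨P.ne_empty hD, P.subset hD⟩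
  · rintro ⟨P, D⟩ h ⟨P', D'⟩ h' heq
    have hD := (mem_sigma.1 h).2
    have hD' := (mem_sigma.1 h').2
    obtain rfl : D = D' := congrArg Sigma.fst heq
    have := congrArg parts (eq_of_heq (Sigma.mk.inj heq).2)
    have hP : P = P' := by
      ext1
      rw [← insert_erase hD, ← insert_erase hD']
      exact congrArg (insert D) this
    rw [hP]
  · rintro ⟨D, P⟩ h
    simp only [mem_sigma, mem_erase, mem_powerset, mem_univ, and_true] at h
    have hdisj : Disjoint (s \ D) D := sdiff_disjoint
    have hD : D ∉ P.parts := fun hD => by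
      obtain ⟨x, hx⟩ := P.nonempty_of_mem_parts hD
      exact (mem_sdiff.1 (P.subset hD hx)).2 hx
    refine ⟨⟨P.extend h.1 hdisj (sdiff_union_of_subset h.2), D⟩, ?_, ?_⟩
    · simp [extend]
    · refine Sigma.ext rfl (heq_of_eq ?_)
      ext1
      exact erase_insert hD
  · rintro ⟨P, D⟩ h
    rfl

end Finpartition

/-! ### The umbral polynomials and their sum over set partitions -/

namespace Polynomial

/-- The monic polynomials `x ∏ (x - ((n - i) + i t))`, `1 ≤ i < n`, in `x` over `ℤ[t]`. -/
noncomputable def umbral : ℕ → ℤ[X][X]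
  | 0 => 1
  | n + 1 => X * ∏ i ∈ range n, (X - C ((n : ℤ[X]) - (i : ℤ[X]) + ((i : ℤ[X]) + 1) * X))

/-- The two shifted products share all linear factors but one, and the shared part is that of
`umbral n`; what remains is a quadratic identity. -/
theorem umbral_difference (n : ℕ) :
    (umbral (n + 1)).comp (X + C X) - (umbral (n + 1)).comp (X + 1) =
      C (X - 1) * (((n + 1 : ℕ) : ℤ[X][X]) * umbral n) := by
  cases n with
  | zero => simp [umbral]
  | succ m =>
    simp only [umbral, mul_comp, prod_comp, X_comp, sub_comp, C_comp]
    -- The unshared factors are the first after the shift by `t` and the last after the shift by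
    -- `1`.
    rw [prod_range_succ', prod_range_succ]
    have h : ∏ k ∈ range m, (X + C X - C (((m + 1 : ℕ) : ℤ[X]) - ((k + 1 : ℕ) : ℤ[X]) +
          (((k + 1 : ℕ) : ℤ[X]) + 1) * X)) =
        ∏ i ∈ range m, (X - C ((m : ℤ[X]) - (i : ℤ[X]) + ((i : ℤ[X]) + 1) * X)) :=
      prod_congr rfl fun i _ => by
        simp only [C_add, C_sub, C_mul, Nat.cast_add, Nat.cast_one, C_1]
        ring
    have h' : ∏ k ∈ range m, (X + 1 - C (((m + 1 : ℕ) : ℤ[X]) - (k : ℤ[X]) +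
          ((k : ℤ[X]) + 1) * X)) =
        ∏ i ∈ range m, (X - C ((m : ℤ[X]) - (i : ℤ[X]) + ((i : ℤ[X]) + 1) * X)) :=
      prod_congr rfl fun i _ => by
        simp only [C_add, C_sub, C_mul, Nat.cast_add, Nat.cast_one, C_1]
        ring
    rw [h, h']
    simp only [C_add, C_sub, C_mul, Nat.cast_add, Nat.cast_one, C_1, map_natCast, Nat.cast_zero,
      C_0]
    ring

theorem umbral_succ_eval_zero (n : ℕ) : (umbral (n + 1)).eval 0 = 0 := by
  simp [umbral]

theorem umbral_succ_coeff_one (n : ℕ) :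
    (umbral (n + 1)).coeff 1 =
      ∏ i ∈ range n, -((n : ℤ[X]) - (i : ℤ[X]) + ((i : ℤ[X]) + 1) * X) := by
  rw [umbral, coeff_X_mul, coeff_zero_eq_eval_zero, eval_prod]
  exact prod_congr rfl fun i _ => by simp only [eval_sub, eval_X, eval_C, zero_sub]

/-- A polynomial that vanishes at `0` and is invariant under a nonzero translation is zero. -/
theorem eq_zero_of_comp_eq {R : Type*} [CommRing R] [IsDomain R] [CharZero R] {a b : R}
    (hab : a ≠ b) {p : R[X]} (h : p.comp (X + C a) = p.comp (X + C b)) (h0 : p.eval 0 = 0) :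
    p = 0 := by
  have hs : ∀ c, p.eval (c + (a - b)) = p.eval c := fun c => by
    have := congrArg (eval (c - b)) h
    simp only [eval_comp, eval_add, eval_X, eval_C, sub_add_cancel] at this
    rwa [sub_add_eq_add_sub, add_sub_assoc] at this
  have hk : ∀ k : ℕ, p.eval (k * (a - b)) = 0 := fun k => by
    induction k with
    | zero => simpa using h0
    | succ k ih => rw [Nat.cast_succ, add_one_mul, hs, ih]
  refine eq_zero_of_infinite_isRoot p ((Set.infinite_range_of_injective
    (f := fun k : ℕ => (k : R) * (a - b)) fun k l hkl => ?_).mono ?_)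
  · exact Nat.cast_injective (mul_right_cancel₀ (sub_ne_zero.2 hab) hkl)
  · rintro _ ⟨k, rfl⟩
    exact hk k

/-- The `q`-integer `1 + X + ⋯ + X ^ (m - 1)`. -/
noncomputable def qInt (m : ℕ) : ℤ[X] := ∑ j ∈ range m, X ^ j

theorem mul_qInt (m : ℕ) : (X - 1) * qInt m = X ^ m - 1 := mul_geom_sum _ _

/-- Induction on `s`: both sides vanish at `x = 0` and have the same difference under the shifts by
`t` and `1`, so their difference is invariant under translation by `t - 1`, hence zero. -/
theorem sum_finpartition_umbral {ι : Type*} [DecidableEq ι] (s : Finset ι) :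
    ∑ P : Finpartition s, (∏ D ∈ P.parts, C (qInt #D)) * umbral #P.parts = X ^ #s := by
  induction s using Finset.strongInduction with
  | H s ih =>
  rcases s.eq_empty_or_nonempty with rfl | hs
  · have : ∀ P : Finpartition (∅ : Finset ι), P.parts = ∅ := fun P => P.parts_eq_empty_iff.2 rfl
    have hc : Fintype.card (Finpartition (∅ : Finset ι)) = 1 :=
      Fintype.card_eq_one_iff.2 ⟨⊥, fun P => by ext1; rw [this, this]⟩
    simp [this, umbral, hc]
  have hpos : ∀ P : Finpartition s, 0 < #P.parts := fun P =>
    card_pos.2 (P.parts_nonempty hs.ne_empty)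
  rw [← sub_eq_zero]
  refine eq_zero_of_comp_eq (a := X) (b := 1) (by simpa using X_ne_C (1 : ℤ)) ?_ ?_
  · have hL : ∀ P : Finpartition s,
        ((∏ D ∈ P.parts, C (qInt #D)) * umbral #P.parts).comp (X + C X) -
          ((∏ D ∈ P.parts, C (qInt #D)) * umbral #P.parts).comp (X + 1) =
        ∑ D ∈ P.parts, C (X - 1) * C (qInt #D) *
          ((∏ E ∈ P.parts.erase D, C (qInt #E)) * umbral #(P.parts.erase D)) := fun P => by
      obtain ⟨k, hk⟩ := Nat.exists_eq_succ_of_ne_zero (hpos P).ne'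
      -- All `k + 1` choices of `D` give the same term, which absorbs the factor `k + 1` of
      -- `umbral_difference`.
      have : ∀ D ∈ P.parts, C (X - 1) * C (qInt #D) *
          ((∏ E ∈ P.parts.erase D, C (qInt #E)) * umbral #(P.parts.erase D)) =
          C (X - 1) * ((∏ E ∈ P.parts, C (qInt #E)) * umbral k) := fun D hD => by
        rw [card_erase_of_mem hD, hk, ← mul_prod_erase _ _ hD]
        simp only [Nat.succ_eq_add_one, Nat.add_sub_cancel]
        ring
      rw [sum_congr rfl this, sum_const, hk]
      simp only [mul_comp, prod_comp, C_comp]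
      rw [← mul_sub, umbral_difference, nsmul_eq_mul]
      ring
    have hR : ∀ D ∈ s.powerset.erase ∅, C (X - 1) * C (qInt #D) * X ^ #(s \ D) =
        C X ^ #D * X ^ (#s - #D) - 1 ^ #D * X ^ (#s - #D) := fun D hD => by
      rw [card_sdiff_of_subset (mem_powerset.1 (mem_of_mem_erase hD)), ← C_mul, mul_qInt]
      simp [sub_mul]
    have key : ∑ P : Finpartition s, (((∏ D ∈ P.parts, C (qInt #D)) * umbral #P.parts).comp
          (X + C X) - ((∏ D ∈ P.parts, C (qInt #D)) * umbral #P.parts).comp (X + 1)) =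
        (X ^ #s : ℤ[X][X]).comp (X + C X) - (X ^ #s : ℤ[X][X]).comp (X + 1) := by
      rw [sum_congr rfl fun P _ => hL P, Finpartition.sum_sum_parts s fun D S =>
        C (X - 1) * C (qInt #D) * ((∏ E ∈ S, C (qInt #E)) * umbral #S)]
      have : ∀ D ∈ s.powerset.erase ∅, ∑ P : Finpartition (s \ D),
          C (X - 1) * C (qInt #D) * ((∏ E ∈ P.parts, C (qInt #E)) * umbral #P.parts) =
          C X ^ #D * X ^ (#s - #D) - 1 ^ #D * X ^ (#s - #D) := fun D hD => by
        rw [← mul_sum, ih (s \ D), hR D hD]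
        have hD' := mem_erase.1 hD
        exact sdiff_ssubset (mem_powerset.1 hD'.2) (nonempty_iff_ne_empty.2 hD'.1)
      -- The term `D = ∅` is zero, so it may be restored; the sums over all subsets are then
      -- binomial expansions of `(t + x)^|s|` and `(1 + x)^|s|`.
      rw [sum_congr rfl this, sum_erase _ (by simp), sum_sub_distrib, sum_pow_mul_eq_add_pow,
        sum_pow_mul_eq_add_pow]
      simp [add_comm]
    rw [sum_sub_distrib] at key
    simp only [sub_comp, Polynomial.sum_comp, C_1]
    linear_combination key
  · simp only [eval_sub, eval_finsetSum, eval_mul, eval_pow, eval_X]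
    rw [zero_pow (card_pos.2 hs).ne', sub_zero]
    refine sum_eq_zero fun P _ => ?_
    obtain ⟨k, hk⟩ := Nat.exists_eq_succ_of_ne_zero (hpos P).ne'
    rw [hk, umbral_succ_eval_zero, mul_zero]

theorem sum_finpartition_coeff_umbral {ι : Type*} [DecidableEq ι] (s : Finset ι) :
    ∑ P : Finpartition s, (∏ D ∈ P.parts, qInt #D) * (umbral #P.parts).coeff 1 =
      if #s = 1 then 1 else 0 := by
  have := congrArg (coeff · 1) (sum_finpartition_umbral s)
  simp only [finsetSum_coeff, ← map_prod, coeff_C_mul, coeff_X_pow] at this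
  rw [this]
  simp only [eq_comm]

end Polynomial

/-- The interval sums determine `g` downward from `b`, by the same recursion that `μ(·, b)`
satisfies. -/
theorem IncidenceAlgebra.mu_eq_of_sum_Icc {α 𝕜 : Type*} [PartialOrder α] [LocallyFiniteOrder α]
    [DecidableEq α] [Ring 𝕜] [WellFoundedGT α] {b : α} {g : α → 𝕜}
    (hg : ∀ a ≤ b, ∑ x ∈ Icc a b, g x = if a = b then 1 else 0) (a : α) (hab : a ≤ b) :
    IncidenceAlgebra.mu 𝕜 a b = g a := by
  induction a using WellFoundedGT.induction with
  | ind a ih =>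
  have h := hg a hab
  rcases eq_or_ne a b with rfl | hne
  · simpa [eq_comm] using h
  · rw [IncidenceAlgebra.mu_eq_neg_sum_Ioc_of_ne hne]
    rw [if_neg hne, ← Ioc_insert_left hab, sum_insert left_notMem_Ioc] at h
    rw [sum_congr rfl fun x hx => ih x (mem_Ioc.1 hx).1 (mem_Ioc.1 hx).2]
    exact (eq_neg_of_add_eq_zero_left h).symm

/-! ### Coarser partitions as partitions of the set of blocks -/

namespace Finpartition

variable {α : Type*} [DecidableEq α] {s : Finset α}

/-- The parts of `P` contained in `B`. -/
def partsIn (P : Finpartition s) (B : Finset α) : Finset (Finset α) := {A ∈ P.parts | A ⊆ B}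

theorem mem_partsIn {P : Finpartition s} {A B : Finset α} :
    A ∈ P.partsIn B ↔ A ∈ P.parts ∧ A ⊆ B := mem_filter

theorem sup_partsIn {P Q : Finpartition s} (h : P ≤ Q) {B : Finset α} (hB : B ∈ Q.parts) :
    (P.partsIn B).sup id = B := by
  ext x
  simp only [mem_sup, mem_partsIn, id]
  constructor
  · rintro ⟨A, ⟨_, hAB⟩, hx⟩
    exact hAB hx
  · intro hx
    obtain ⟨A, hA, hxA⟩ := P.exists_mem (Q.subset hB hx)
    obtain ⟨B', hB', hAB'⟩ := h hA
    obtain rfl := Q.eq_of_mem_parts hB' hB (hAB' hxA) hx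
    exact ⟨A, ⟨hA, hAB'⟩, hxA⟩

theorem injOn_partsIn {P Q : Finpartition s} (h : P ≤ Q) :
    Set.InjOn P.partsIn (Q.parts : Set (Finset α)) := fun B hB C hC hBC => by
  rw [← sup_partsIn h hB, ← sup_partsIn h hC, hBC]

theorem disjoint_partsIn (P Q : Finpartition s) :
    (Q.parts : Set (Finset α)).PairwiseDisjoint P.partsIn := by
  intro B hB C hC hne
  rw [Function.onFun, Finset.disjoint_left]
  intro A hAB hAC
  rw [mem_partsIn] at hAB hAC
  obtain ⟨x, hx⟩ := P.nonempty_of_mem_parts hAB.1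
  exact hne (Q.eq_of_mem_parts hB hC (hAB.2 hx) (hAC.2 hx))

theorem biUnion_partsIn {P Q : Finpartition s} (h : P ≤ Q) :
    Q.parts.biUnion P.partsIn = P.parts := by
  ext A
  simp only [mem_biUnion, mem_partsIn]
  exact ⟨fun ⟨_, _, hA, _⟩ => hA, fun hA => (h hA).imp fun B hB => ⟨hB.1, hA, hB.2⟩⟩

theorem sum_sum_partsIn {M : Type*} [AddCommMonoid M] {P Q : Finpartition s} (h : P ≤ Q)
    (f : Finset α → M) : ∑ B ∈ Q.parts, ∑ A ∈ P.partsIn B, f A = ∑ A ∈ P.parts, f A := by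
  rw [← sum_biUnion (disjoint_partsIn P Q), biUnion_partsIn h]

/-- The partition of the set of parts of `P` given by a partition coarser than `P`. -/
def onParts {P Q : Finpartition s} (h : P ≤ Q) : Finpartition P.parts where
  parts := Q.parts.image P.partsIn
  supIndep := by
    rw [supIndep_iff_pairwiseDisjoint, coe_image]
    rintro _ ⟨B, hB, rfl⟩ _ ⟨C, hC, rfl⟩ hne
    exact disjoint_partsIn P Q hB hC fun hBC => hne (hBC ▸ rfl)
  sup_parts := by
    rw [sup_image, Function.id_comp, sup_eq_biUnion, biUnion_partsIn h]
  bot_notMem hb := by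
    obtain ⟨B, hB, hB'⟩ := mem_image.1 hb
    have := sup_partsIn h hB
    rw [hB'] at this
    exact Q.ne_bot hB (by simpa using this.symm)

/-- The partition coarser than `P` given by a partition of the set of parts of `P`. -/
def ofOnParts {P : Finpartition s} (R : Finpartition P.parts) : Finpartition s where
  parts := R.parts.image fun D => D.sup id
  supIndep := by
    rw [supIndep_iff_pairwiseDisjoint, coe_image]
    rintro _ ⟨D, hD, rfl⟩ _ ⟨E, hE, rfl⟩ hne
    rw [Function.onFun, id, id, Finset.disjoint_left]
    intro x hx hx'
    obtain ⟨A, hA, hxA⟩ := mem_sup.1 hx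
    obtain ⟨A', hA', hxA'⟩ := mem_sup.1 hx'
    obtain rfl := P.eq_of_mem_parts (R.subset hD hA) (R.subset hE hA') hxA hxA'
    exact hne (by rw [R.eq_of_mem_parts hD hE hA hA'])
  sup_parts := by
    ext x
    simp only [sup_image, mem_sup, Function.comp, id]
    constructor
    · rintro ⟨D, hD, A, hA, hx⟩
      exact P.subset (R.subset hD hA) hx
    · intro hx
      obtain ⟨A, hA, hxA⟩ := P.exists_mem hx
      obtain ⟨D, hD, hAD⟩ := R.exists_mem hA
      exact ⟨D, hD, A, hAD, hxA⟩
  bot_notMem hb := by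
    obtain ⟨D, hD, hD'⟩ := mem_image.1 hb
    obtain ⟨A, hA⟩ := R.nonempty_of_mem_parts hD
    exact P.ne_bot (R.subset hD hA) (le_bot_iff.1 (hD' ▸ le_sup (f := id) hA))

theorem le_ofOnParts {P : Finpartition s} (R : Finpartition P.parts) : P ≤ ofOnParts R := by
  intro A hA
  obtain ⟨D, hD, hAD⟩ := R.exists_mem hA
  exact ⟨_, mem_image_of_mem _ hD, le_sup (f := id) hAD⟩

theorem partsIn_sup {P : Finpartition s} (R : Finpartition P.parts) {D : Finset (Finset α)}
    (hD : D ∈ R.parts) : P.partsIn (D.sup id) = D := by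
  ext A
  rw [mem_partsIn]
  constructor
  · rintro ⟨hA, hAD⟩
    obtain ⟨x, hx⟩ := P.nonempty_of_mem_parts hA
    obtain ⟨A', hA', hxA'⟩ := mem_sup.1 (hAD hx)
    rwa [P.eq_of_mem_parts hA (R.subset hD hA') hx hxA']
  · exact fun hA => ⟨R.subset hD hA, le_sup (f := id) hA⟩

open Classical in
/-- Partitions coarser than `P` are partitions of the set of parts of `P`. -/
theorem sum_coarser {M : Type*} [AddCommMonoid M] (P : Finpartition s)
    (F : Finset (Finset (Finset α)) → M) :
    ∑ Q : Finpartition s with P ≤ Q, F (Q.parts.image P.partsIn) =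
      ∑ R : Finpartition P.parts, F R.parts := by
  refine sum_bij (fun Q hQ => onParts (mem_filter.1 hQ).2) (fun _ _ => mem_univ _) ?_ ?_ ?_
  · intro Q hQ Q' hQ' heq
    have hsup : ∀ {Q : Finpartition s}, P ≤ Q →
        (Q.parts.image P.partsIn).image (fun D => D.sup id) = Q.parts := fun {Q} h => by
      rw [image_image]
      exact (image_congr fun B hB => sup_partsIn h hB).trans image_id
    ext1
    rw [← hsup (mem_filter.1 hQ).2, ← hsup (mem_filter.1 hQ').2]
    exact congrArg (fun R : Finpartition P.parts => R.parts.image fun D => D.sup id) heq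
  · intro R _
    refine ⟨ofOnParts R, mem_filter.2 ⟨mem_univ _, le_ofOnParts R⟩, ?_⟩
    ext1
    simp only [onParts, ofOnParts, image_image]
    exact (image_congr fun D hD => partsIn_sup R hD).trans image_id
  · intro Q _
    rfl

end Finpartition

/-! ### The Möbius function below a one-block weighted partition -/

namespace WeightedPartition

variable {α : Type*} [Fintype α] [DecidableEq α]

/-- The sum of the weights of all blocks. -/
def totalWeight (P : WeightedPartition α) : ℕ := ∑ B ∈ P.partition.parts, P.weight B

theorem blocksIn_eq_partsIn (P : WeightedPartition α) (B : Finset α) :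
    P.blocksIn B = P.partition.partsIn B := rfl

theorem sum_weight_add_card_le (P : WeightedPartition α) (B : Finset α) :
    ∑ A ∈ P.blocksIn B, P.weight A + #(P.blocksIn B) ≤ #B := by
  calc ∑ A ∈ P.blocksIn B, P.weight A + #(P.blocksIn B)
      = ∑ A ∈ P.blocksIn B, (P.weight A + 1) := by rw [sum_add_distrib, card_eq_sum_ones]
    _ ≤ ∑ A ∈ P.blocksIn B, #A :=
        sum_le_sum fun A hA => P.weight_lt A (mem_filter.1 hA).1
    _ = #((P.blocksIn B).biUnion id) := (card_biUnion fun A hA A' hA' hne =>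
        P.partition.disjoint (mem_filter.1 hA).1 (mem_filter.1 hA').1 hne).symm
    _ ≤ #B := card_le_card (biUnion_subset.2 fun A hA => (mem_filter.1 hA).2)

/-- The weighted partition with underlying partition `Q`, coarser than that of `P`, whose blocks
`B` have weight `p B` plus the weight of `P` in `B`. -/
def raise (P : WeightedPartition α) (Q : Finpartition (univ : Finset α))
    (p : ∀ B ∈ Q.parts, ℕ) (hp : ∀ B hB, p B hB < #(P.blocksIn B)) : WeightedPartition α where
  partition := Q
  weight B := if hB : B ∈ Q.parts then ∑ A ∈ P.blocksIn B, P.weight A + p B hB else 0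
  weight_lt B hB := by
    rw [dif_pos hB]
    exact (Nat.add_lt_add_left (hp B hB) _).trans_le (P.sum_weight_add_card_le B)
  weight_eq_zero B hB := dif_neg hB

-- Once `Q` is fixed, the excess weights of its blocks vary independently, each over `range
-- #(P.blocksIn B)`, so the generating function factors.
open Classical Polynomial in
theorem sum_ge_of_partition_eq (P : WeightedPartition α) {Q : Finpartition (univ : Finset α)}
    (hQ : P.partition ≤ Q) :
    ∑ R : WeightedPartition α with P ≤ R ∧ R.partition = Q, (X : ℤ[X]) ^ R.totalWeight =
      X ^ P.totalWeight * ∏ B ∈ Q.parts, qInt #(P.blocksIn B) := by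
  simp only [qInt]
  rw [prod_sum, mul_sum]
  have hle : ∀ R ∈ ({R | P ≤ R ∧ R.partition = Q} : Finset (WeightedPartition α)), ∀ B ∈ Q.parts,
      ∃ j < #(P.blocksIn B), R.weight B = ∑ A ∈ P.blocksIn B, P.weight A + j := by
    intro R hR B hB
    obtain ⟨h, rfl⟩ := (mem_filter.1 hR).2
    exact h.2 B hB
  refine sum_bij (fun R _ B _ => R.weight B - ∑ A ∈ P.blocksIn B, P.weight A) ?_ ?_ ?_ ?_
  · intro R hR
    refine Finset.mem_pi.2 fun B hB => ?_
    obtain ⟨j, hj, hw⟩ := hle R hR B hB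
    rw [mem_range]
    omega
  · intro R hR R' hR' heq
    have hRQ := (mem_filter.1 hR).2.2
    have hRQ' := (mem_filter.1 hR').2.2
    refine WeightedPartition.ext (hRQ.trans hRQ'.symm) (funext fun B => ?_)
    by_cases hB : B ∈ Q.parts
    · obtain ⟨j, -, hw⟩ := hle R hR B hB
      obtain ⟨j', -, hw'⟩ := hle R' hR' B hB
      have : R.weight B - ∑ A ∈ P.blocksIn B, P.weight A =
        R'.weight B - ∑ A ∈ P.blocksIn B, P.weight A := congrFun (congrFun heq B) hB
      omega
    · rw [R.weight_eq_zero B (hRQ ▸ hB), R'.weight_eq_zero B (hRQ' ▸ hB)]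
  · intro p hp
    have hp' : ∀ B hB, p B hB < #(P.blocksIn B) := fun B hB =>
      mem_range.1 (Finset.mem_pi.1 hp B hB)
    refine ⟨P.raise Q p hp', mem_filter.2 ⟨mem_univ _, ⟨hQ, fun B hB => ⟨p B hB, hp' B hB, ?_⟩⟩,
      rfl⟩, ?_⟩
    · exact dif_pos hB
    · funext B hB
      simp [raise, hB]
  · intro R hR
    obtain ⟨-, rfl⟩ := (mem_filter.1 hR).2
    rw [prod_attach R.partition.parts
      (fun B => (X : ℤ[X]) ^ (R.weight B - ∑ A ∈ P.blocksIn B, P.weight A)),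
      prod_pow_eq_pow_sum, ← pow_add, totalWeight, totalWeight,
      ← Finpartition.sum_sum_partsIn hQ, ← sum_add_distrib]
    refine congrArg _ (sum_congr rfl fun B hB => ?_)
    obtain ⟨j, -, hw⟩ := hle R hR B hB
    rw [← blocksIn_eq_partsIn]
    omega

-- Grouping by underlying partition reduces this to the coefficient identity on the set of blocks of
-- `P`.
open Classical Polynomial in
theorem sum_ge (P : WeightedPartition α) :
    ∑ R : WeightedPartition α with P ≤ R,
      (X : ℤ[X]) ^ R.totalWeight * (umbral #R.partition.parts).coeff 1 =
      X ^ P.totalWeight * if #P.partition.parts = 1 then 1 else 0 := by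
  rw [← sum_finpartition_coeff_umbral P.partition.parts, ← Finpartition.sum_coarser P.partition
    (fun S => (∏ D ∈ S, qInt #D) * (umbral #S).coeff 1), mul_sum,
    ← sum_fiberwise_of_maps_to (g := WeightedPartition.partition)
      (t := ({Q | P.partition ≤ Q} : Finset (Finpartition (univ : Finset α))))
      (fun R hR => mem_filter.2 ⟨mem_univ _, (mem_filter.1 hR).2.1⟩)]
  refine sum_congr rfl fun Q hQ => ?_
  have hPQ := (mem_filter.1 hQ).2
  have hinj := Finpartition.injOn_partsIn hPQ
  rw [prod_image hinj, card_image_of_injOn hinj, ← mul_assoc]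
  refine Eq.trans ?_ (congrArg (· * _) (P.sum_ge_of_partition_eq hPQ))
  rw [filter_filter, sum_mul]
  exact sum_congr rfl fun R hR => by rw [(mem_filter.1 hR).2.2]

theorem le_full_iff {P : WeightedPartition α} {i : ℕ} (hi : i < Fintype.card α) :
    P ≤ full i hi ↔ P.totalWeight ≤ i ∧ i - P.totalWeight < #P.partition.parts := by
  have hb : P.blocksIn univ = P.partition.parts := filter_true_of_mem fun _ _ => subset_univ _
  have hparts : (full i hi).partition.parts = {univ} := rfl
  have hw : (full i hi).weight univ = i := if_pos rfl
  rw [le_def, hparts]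
  simp only [mem_singleton, forall_eq, hb, hw]
  constructor
  · rintro ⟨-, j, hj, h⟩
    rw [totalWeight]
    omega
  · rintro ⟨h₁, h₂⟩
    refine ⟨fun A hA => ⟨univ, by rw [hparts]; exact mem_singleton_self _, subset_univ _⟩,
      _, h₂, ?_⟩
    rw [totalWeight] at *
    omega

theorem eq_full_iff {P : WeightedPartition α} {i : ℕ} (hi : i < Fintype.card α) :
    P = full i hi ↔ #P.partition.parts = 1 ∧ P.totalWeight = i := by
  have hparts : (full i hi).partition.parts = {univ} := rfl
  have hw : (full i hi).weight univ = i := if_pos rfl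
  constructor
  · rintro rfl
    rw [totalWeight, hparts, sum_singleton, card_singleton, hw]
    exact ⟨rfl, rfl⟩
  · rintro ⟨h₁, h₂⟩
    obtain ⟨B, hB⟩ := card_eq_one.1 h₁
    have hBu : B = univ := by
      have := P.partition.sup_parts
      rwa [hB, sup_singleton] at this
    subst hBu
    refine WeightedPartition.ext (Finpartition.ext (hB.trans hparts.symm)) (funext fun A => ?_)
    by_cases hA : A = univ
    · rw [hA, hw, ← h₂, totalWeight, hB, sum_singleton]
    · rw [P.weight_eq_zero A (by simpa [hB] using hA),
        weight_eq_zero _ A (by simpa [hparts] using hA)]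

open Polynomial in
theorem natDegree_umbral_coeff_one_lt {k : ℕ} (hk : 0 < k) :
    ((umbral k).coeff 1).natDegree < k := by
  obtain ⟨m, rfl⟩ := Nat.exists_eq_succ_of_ne_zero hk.ne'
  rw [Nat.succ_eq_add_one, umbral_succ_coeff_one, Nat.lt_succ_iff]
  refine (natDegree_prod_le _ _).trans ((sum_le_card_nsmul _ _ 1 fun i _ => ?_).trans (by simp))
  rw [natDegree_neg]
  have : ((m : ℤ[X]) - (i : ℤ[X]) + ((i : ℤ[X]) + 1) * X) =
      C ((i : ℤ) + 1) * X + C ((m : ℤ) - i) := by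
    simp only [C_add, C_sub, C_1, map_natCast]
    ring
  rw [this]
  exact natDegree_linear_le

open Polynomial in
theorem mu_full (P : WeightedPartition α) {i : ℕ} (hi : i < Fintype.card α) (hP : P ≤ full i hi) :
    IncidenceAlgebra.mu ℤ P (full i hi) =
      ((X : ℤ[X]) ^ P.totalWeight * (umbral #P.partition.parts).coeff 1).coeff i := by
  classical
  refine IncidenceAlgebra.mu_eq_of_sum_Icc (g := fun P : WeightedPartition α =>
    ((X : ℤ[X]) ^ P.totalWeight * (umbral #P.partition.parts).coeff 1).coeff i) (fun P _ => ?_) P hP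
  have hsub : Icc P (full i hi) ⊆ ({R | P ≤ R} : Finset (WeightedPartition α)) := fun R hR =>
    mem_filter.2 ⟨mem_univ _, (mem_Icc.1 hR).1⟩
  -- The interval is enlarged to the whole up-set of `P`, where `sum_ge` applies; the added terms
  -- are shown to vanish below.
  rw [sum_subset hsub, ← finsetSum_coeff, sum_ge, coeff_X_pow_mul']
  · simp only [eq_full_iff]
    by_cases h : #P.partition.parts = 1
    · simp only [h, if_true, coeff_one, ← ite_and, true_and]
      exact if_congr (by omega) rfl rfl
    · simp [h]
  · intro R hR hR'
    have hnot : ¬ R ≤ full i hi := fun h => hR' (mem_Icc.2 ⟨(mem_filter.1 hR).2, h⟩)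
    rw [le_full_iff, not_and, not_lt] at hnot
    rw [coeff_X_pow_mul']
    split_ifs with h
    -- Here `w(R) ≤ i` but `i - w(R) ≥ #R`, beyond the degree of `c_{#R}`; in the other case the
    -- power of `t` already exceeds `i`.
    · refine coeff_eq_zero_of_natDegree_lt ((natDegree_umbral_coeff_one_lt ?_).trans_le (hnot h))
      refine card_pos.2 (R.partition.parts_nonempty ?_)
      exact (card_pos.1 (card_univ (α := α) ▸ Nat.zero_lt_of_lt hi)).ne_empty
    · rfl

open Polynomial in
theorem moebius_eq_coeff (n : ℕ) (i : Fin n) : moebius n i = ((umbral n).coeff 1).coeff i := by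
  have h0 : (⊥ : WeightedPartition (Fin n)).totalWeight = 0 := sum_eq_zero fun _ _ => rfl
  have hc : #(⊥ : WeightedPartition (Fin n)).partition.parts = n :=
    (Finpartition.card_bot _).trans (by simp)
  rw [moebius, mu_full _ _ bot_le, h0, hc, pow_zero, one_mul]

end WeightedPartition

theorem mainTheorem3 (n : ℕ) (hn : 1 ≤ n) :
    (∑ i : Fin n, Polynomial.C (WeightedPartition.moebius n i) * Polynomial.X ^ (i : ℕ) =
      (-1) ^ (n - 1) * ∏ i ∈ Finset.Icc 1 (n - 1),
        (Polynomial.C ((n : ℤ) - (i : ℤ)) + Polynomial.C (i : ℤ) * Polynomial.X)) ∧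
    ∑ i : Fin n, WeightedPartition.moebius n i = (-1) ^ (n - 1) * (n : ℤ) ^ (n - 1) := by
  have key : ∑ i : Fin n, Polynomial.C (WeightedPartition.moebius n i) * Polynomial.X ^ (i : ℕ) =
      (-1) ^ (n - 1) * ∏ i ∈ Finset.Icc 1 (n - 1),
        (Polynomial.C ((n : ℤ) - (i : ℤ)) + Polynomial.C (i : ℤ) * Polynomial.X) := by
    simp only [WeightedPartition.moebius_eq_coeff]
    -- The degree bound makes the `n` coefficients with `i < n` recover all of `c_n`.
    rw [Fin.sum_univ_eq_sum_range (fun i => Polynomial.C (((Polynomial.umbral n).coeff 1).coeff i) *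
      Polynomial.X ^ i), ← Polynomial.as_sum_range_C_mul_X_pow' _
        (WeightedPartition.natDegree_umbral_coeff_one_lt hn)]
    obtain ⟨m, rfl⟩ := Nat.exists_eq_add_of_le' hn
    rw [Polynomial.umbral_succ_coeff_one, prod_neg, card_range, Nat.add_sub_cancel,
      ← Finset.Ico_add_one_right_eq_Icc, prod_Ico_eq_prod_range, Nat.add_sub_cancel]
    refine congrArg _ (prod_congr rfl fun i _ => ?_)
    simp only [Polynomial.C_sub, Nat.cast_add, Nat.cast_one, Polynomial.C_add, Polynomial.C_1,
      map_natCast]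
    ring
  refine ⟨key, ?_⟩
  have := congrArg (Polynomial.eval 1) key
  simpa [Polynomial.eval_finsetSum, Polynomial.eval_prod] using this
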